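/- Let $X$ be a compact metric space with metric $d$ and $T\colon X\to X$ a continuous map. Let $\mathcal M_{\rm inv}$ be the set of $T$-invariant Borel probability measures on $X$, and for $\mu\in\mathcal M_{\rm inv}$ let $h_\mu\in[0,\infty]$ be its measure-theoretic (Kolmogorov–Sinai) entropy and $$G_\mu=\Bigl\{x\in X:\ \tfrac1n\sum_{j=0}^{n-1}\delta_{T^jx}\to\mu\ \text{in the weak-star topology}\Bigr\}$$ the set of its generic points. For $Z\subset X$ let $h_{\rm top}(Z)\in[0,\infty]$ be Bowen's topological entropy: with $B_n(x,\epsilon)=\{y: \max_{0\le j<n}d(T^jx,T^jy)<\epsilon\}$ and, for $s\ge 0$, $$H^s_N(Z,\epsilon)=\inf\Bigl\{\sum_i e^{-sn_i}:\ Z\subset\bigcup_i B_{n_i}(x_i,\epsilon),\ n_i\ge \max(N,1)\ \text{for all } i\Bigr\}$$ (at most countable covers), put $H^s(Z,\epsilon)=\lim_{N\to\infty}H^s_N(Z,\epsilon)$, $h_{\rm top}(Z,\epsilon)=\inf\{s\ge0: H^s(Z,\epsilon)=0\}$ and $h_{\rm top}(Z)=\lim_{\epsilon\to0}h_{\rm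 top}(Z,\epsilon)$; in particular $h_{\rm top}(\emptyset)=0$. Suppose that $(X,T)$ is saturated, that is, $h_{\rm top}(G_\mu)=h_\mu$ for every $\mu\in\mathcal M_{\rm inv}$. Let $\mathbb B$ be a real Banach space with dual $\mathbb B^*$, let $\Phi\colon X\to\mathbb B^*$ be continuous for the weak-star topology of $\mathbb B^*$, let $\alpha\in\mathbb B^*$ and $E\subset\mathbb B$. With $A_n\Phi(x)=\frac1n\sum_{j=0}^{n-1}\Phi(T^jx)$, put $$X_\Phi(\alpha;E)=\Bigl\{x\in X:\ \limsup_{n\to\infty}\langle A_n\Phi(x),w\rangle\le\langle\alpha,w\rangle\ \text{for all } w\in E\Bigr\},$$ $$\mathcal M_\Phi(\alpha;E)=\Bigl\{\mu\in\mathcal M_{\rm inv}:\ \int\langle\Phi,w\rangle\,d\mu\le\langle\alpha,w\rangle\ \text{for all } w\in E\Bigr\}.$$ Then: (a) if $\mathcal M_\Phi(\alpha;E)=\emptyset$, then $X_\Phi(\alpha;E)=\emptyset$; (b) if $\mathcal M_\Phi(\alpha;E)\neq\emptyset$, then $$h_{\rm top}\bigl(X_\Phi(\alpha;E)\bigr)=\sup_{\mu\in\mathcal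 M_\Phi(\alpha;E)}h_\mu .$$ -/

import Mathlib

open MeasureTheory Filter Topology
open scoped ENNReal NNReal

noncomputable section

namespace DynSys

/-! ### Bowen's topological entropy of a subset -/

section Topological

variable {X : Type*} [MetricSpace X]

/-- The open ball `B_n(x, ε)` for the Bowen metric `d_n(x, y) = max_{0 ≤ j < n} d(T^j x, T^j y)`. -/
def bowenBall (T : X → X) (n : ℕ) (x : X) (ε : ℝ) : Set X :=
  {y | ∀ j < n, dist (T^[j] y) (T^[j] x) < ε}

/-- `R` encodes the at most countable collection of the balls `B_n(x, ε)`, `(x, n) ∈ R`; it covers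
`Z`, and all the lengths are at least `max N 1`. -/
structure IsBowenCover (T : X → X) (Z : Set X) (ε : ℝ) (N : ℕ) (R : Set (X × ℕ)) : Prop where
  countable : R.Countable
  one_le : ∀ p ∈ R, 1 ≤ p.2
  le : ∀ p ∈ R, N ≤ p.2
  covers : Z ⊆ ⋃ p ∈ R, bowenBall T p.2 p.1 ε

/-- `H^s_N(Z, ε) = inf_R ∑_i exp(-s n_i)`. -/
def bowenPreMeasure (T : X → X) (s : ℝ≥0) (Z : Set X) (ε : ℝ) (N : ℕ) : ℝ≥0∞ :=
  ⨅ (R : Set (X × ℕ)) (_ : IsBowenCover T Z ε N R),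
    ∑' p : R, ENNReal.ofReal (Real.exp (-(s : ℝ) * ((p : X × ℕ).2 : ℝ)))

/-- `H^s(Z, ε)`, the limit of `H^s_N(Z, ε)` as `N → ∞`; the sequence is non-decreasing in `N`, so
the limit is the supremum. -/
def bowenMeasure (T : X → X) (s : ℝ≥0) (Z : Set X) (ε : ℝ) : ℝ≥0∞ :=
  ⨆ N : ℕ, bowenPreMeasure T s Z ε N

/-- `h_top(Z, ε)`, the critical value of `s ≥ 0` above which `H^s(Z, ε)` vanishes. -/
def topEntropyAt (T : X → X) (Z : Set X) (ε : ℝ) : ℝ≥0∞ :=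
  ⨅ (s : ℝ≥0) (_ : bowenMeasure T s Z ε = 0), (s : ℝ≥0∞)

/-- Bowen's topological entropy `h_top(Z) = lim_{ε → 0} h_top(Z, ε)`; as `h_top(Z, ε)` is
non-increasing in `ε`, the limit is the supremum over `ε > 0`. -/
def topEntropy (T : X → X) (Z : Set X) : ℝ≥0∞ :=
  ⨆ (ε : ℝ) (_ : 0 < ε), topEntropyAt T Z ε

end Topological

/-! ### Measure-theoretic entropy -/

section Metric

variable {X : Type*} [MeasurableSpace X]

/-- A finite measurable partition is given by its labelling `ξ : X → Fin k`. This is the Shannon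
entropy `-∑ μ(C) log μ(C)` of the join of `ξ, T⁻¹ξ, …, T^{-(n-1)}ξ`, whose cells are the sets
`{x | ξ (T^j x) = a j for all j < n}`. -/
def joinEntropy (T : X → X) (μ : Measure X) {k : ℕ} (ξ : X → Fin k) (n : ℕ) : ℝ :=
  ∑ a : Fin n → Fin k, Real.negMulLog (μ.real {x | ∀ j : Fin n, ξ (T^[j] x) = a j})

/-- `h_μ(T, ξ)`, the limit of `joinEntropy T μ ξ n / n`; for an invariant `μ` the limit exists. -/
def partitionEntropy (T : X → X) (μ : Measure X) {k : ℕ} (ξ : X → Fin k) : ℝ≥0∞ :=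
  limsup (fun n : ℕ => ENNReal.ofReal (joinEntropy T μ ξ n / n)) atTop

/-- The Kolmogorov–Sinai entropy `h_μ`: the supremum over all finite measurable partitions. -/
def measureEntropy (T : X → X) (μ : Measure X) : ℝ≥0∞ :=
  ⨆ (k : ℕ) (ξ : X → Fin k) (_ : Measurable ξ), partitionEntropy T μ ξ

/-- The set of invariant probability measures. -/
def invariantMeasures (T : X → X) : Set (ProbabilityMeasure X) :=
  {μ | MeasurePreserving T (μ : Measure X) (μ : Measure X)}

/-- The empirical measure `(1/n) ∑_{j<n} δ_{T^j x}` (a probability measure for `n ≥ 1`). -/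
def empiricalMeasure (T : X → X) (n : ℕ) (x : X) : FiniteMeasure X :=
  (n : ℝ≥0)⁻¹ • ∑ j ∈ Finset.range n, (diracProba (T^[j] x)).toFiniteMeasure

end Metric

/-! ### Generic points and saturated systems -/

section Saturated

variable {X : Type*} [MetricSpace X] [MeasurableSpace X] [BorelSpace X]

/-- The set `G_μ` of `μ`-generic points. -/
def genericPoints (T : X → X) (μ : ProbabilityMeasure X) : Set X :=
  {x | Tendsto (fun n : ℕ => empiricalMeasure T n x) atTop (𝓝 μ.toFiniteMeasure)}

/-- `(X, T)` is saturated: `h_top(G_μ) = h_μ` for every invariant probability measure `μ`. -/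
def IsSaturated (T : X → X) : Prop :=
  ∀ μ ∈ invariantMeasures T, topEntropy T (genericPoints T μ) = measureEntropy T (μ : Measure X)

end Saturated

/-! ### Birkhoff averages with values in a dual Banach space -/

section Birkhoff

variable {X : Type*} {B : Type*} [NormedAddCommGroup B] [NormedSpace ℝ B]

/-- `X_Φ(α; E)`: the points `x` with `limsup ⟨A_n Φ(x), w⟩ ≤ ⟨α, w⟩` for all `w ∈ E`. The upper
limit is taken in the extended reals. -/
def levelSet (T : X → X) (Φ : X → WeakDual ℝ B) (α : WeakDual ℝ B) (E : Set B) : Set X :=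
  {x | ∀ w ∈ E,
    limsup (fun n : ℕ => (((birkhoffAverage ℝ T Φ n x) w : ℝ) : EReal)) atTop
      ≤ ((α w : ℝ) : EReal)}

/-- `M_Φ(α; E)`: the invariant probability measures `μ` with `∫ ⟨Φ, w⟩ dμ ≤ ⟨α, w⟩` for all
`w ∈ E`. -/
def levelMeasures [MeasurableSpace X] (T : X → X) (Φ : X → WeakDual ℝ B) (α : WeakDual ℝ B)
    (E : Set B) : Set (ProbabilityMeasure X) :=
  {μ | μ ∈ invariantMeasures T ∧ ∀ w ∈ E, ∫ x, Φ x w ∂(μ : Measure X) ≤ α w}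

end Birkhoff

end DynSys

end

noncomputable section

namespace DynSys

/-! ### Limit distributions of orbits -/

section Empirical

variable {X : Type*} [MetricSpace X] [MeasurableSpace X] [BorelSpace X]

/-! By compactness every orbit has a limit distribution. It is invariant, and for `x` in the level
set it satisfies the integral constraints, because `y ↦ Φ y w` is continuous; this already gives
(a). The lower bound in (b) is where saturation enters: generic points of an admissible `μ` lie in
the level set.

The upper bound is Bowen's (`topEntropy_le_of_forall_exists_limit`): if each point of `Z` has some
limit distribution of entropy at most `t`, then `h_top(Z) ≤ t`. Take a fine partition with `μ`-null
boundaries and a length `m` at which the join has entropy below `m (t + δ)`. A Shannon code for its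
`m`-words has small mean length under `μ`, hence along the orbit at infinitely many times, hence
along disjoint `m`-blocks after a suitable shift (`exists_mem_codedSet`). Kraft's inequality bounds
the number of cheap concatenations of `L` words, so the corresponding Bowen balls have geometrically
small total weight (`bowenPreMeasure_codedSet`). Rational code lengths leave only countably many
cases. -/

lemma integral_empiricalMeasure (T : X → X) (f : X → ℝ) (n : ℕ) (x : X) :
    ∫ y, f y ∂(empiricalMeasure T n x : Measure X) = birkhoffAverage ℝ T f n x := by
  simp only [empiricalMeasure, FiniteMeasure.toMeasure_smul, FiniteMeasure.toMeasure_sum,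
    birkhoffAverage, birkhoffSum]
  rw [integral_smul_nnreal_measure, integral_finsetSum_measure]
  · have (i : ℕ) : ∫ y, f y ∂(diracProba (T^[i] x) : Measure X) = f (T^[i] x) :=
      integral_dirac f _
    simp [NNReal.smul_def, this]
  · intro i _
    exact integrable_dirac (by simp)

lemma mass_empiricalMeasure (T : X → X) {n : ℕ} (hn : n ≠ 0) (x : X) :
    (empiricalMeasure T n x).mass = 1 := by
  have h := integral_empiricalMeasure T (fun _ => (1 : ℝ)) n x
  have h' : birkhoffAverage ℝ T (fun _ => (1 : ℝ)) n x = 1 := by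
    simp [birkhoffAverage, birkhoffSum, hn]
  rw [h'] at h
  simp only [integral_const, smul_eq_mul, mul_one] at h
  exact NNReal.coe_injective h

/-- The orbit of every point of a compact space has a limit distribution along some filter. -/
lemma exists_tendsto_empiricalMeasure [CompactSpace X] (T : X → X) (x : X) :
    ∃ (F : Filter ℕ) (μ : ProbabilityMeasure X), F.NeBot ∧ F ≤ atTop ∧
      Tendsto (fun n => empiricalMeasure T n x) F (𝓝 μ.toFiniteMeasure) := by
  -- A free ultrafilter replaces a convergent subsequence. The mass is 1 only eventually: at `n = 0`
  -- the empirical measure is zero.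
  let U : Ultrafilter ℕ := hyperfilter ℕ
  have hU : (U : Filter ℕ) ≤ atTop := Nat.hyperfilter_le_atTop
  have hmem : ∀ᶠ n in (U : Filter ℕ), (empiricalMeasure T n x).mass = 1 :=
    hU ((eventually_ne_atTop 0).mono fun n hn => mass_empiricalMeasure T hn x)
  obtain ⟨ν, hν, hlim⟩ :=
    (isCompact_setOfPred_finiteMeasure_eq_of_compactSpace X 1).ultrafilter_le_nhds'
    (U.map fun n => empiricalMeasure T n x) hmem
  refine ⟨U, ⟨ν, ⟨?_⟩⟩, U.neBot, hU, hlim⟩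
  rw [← FiniteMeasure.ennreal_mass, show ν.mass = 1 from hν]
  rfl

variable {T : X → X} {x : X} {F : Filter ℕ} {μ : ProbabilityMeasure X}

lemma tendsto_birkhoffAverage_of_tendsto_empiricalMeasure [CompactSpace X]
    (h : Tendsto (fun n => empiricalMeasure T n x) F (𝓝 μ.toFiniteMeasure))
    {f : X → ℝ} (hf : Continuous f) :
    Tendsto (fun n => birkhoffAverage ℝ T f n x) F (𝓝 (∫ y, f y ∂(μ : Measure X))) := by
  have := FiniteMeasure.tendsto_iff_forall_integral_tendsto.1 h
    (BoundedContinuousFunction.mkOfCompact ⟨f, hf⟩)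
  simpa [integral_empiricalMeasure] using this

/-- Shifting the starting point from `x` to `T x` changes the averages of a bounded function by
`O(1/n)`, so `f` and `f ∘ T` have the same integral in the limit. -/
lemma measurePreserving_of_tendsto_empiricalMeasure [CompactSpace X] [F.NeBot] (hF : F ≤ atTop)
    (hT : Continuous T)
    (h : Tendsto (fun n => empiricalMeasure T n x) F (𝓝 μ.toFiniteMeasure)) :
    MeasurePreserving T (μ : Measure X) (μ : Measure X) := by
  refine ⟨hT.measurable, ?_⟩
  have : IsProbabilityMeasure ((μ : Measure X).map T) :=
    Measure.isProbabilityMeasure_map hT.measurable.aemeasurable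
  refine ext_of_forall_integral_eq_of_IsFiniteMeasure fun f => ?_
  rw [integral_map hT.measurable.aemeasurable f.continuous.aestronglyMeasurable]
  have h₁ := tendsto_birkhoffAverage_of_tendsto_empiricalMeasure h f.continuous
  have h₂ := tendsto_birkhoffAverage_of_tendsto_empiricalMeasure h (f.continuous.comp hT)
  have h₃ := (tendsto_birkhoffAverage_apply_sub_birkhoffAverage' (𝕜 := ℝ)
    (f.isBounded_range) T x).mono_left hF
  have h₄ : ∀ n, birkhoffAverage ℝ T (f ∘ T) n x = birkhoffAverage ℝ T f n (T x) := fun n => by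
    simp only [birkhoffAverage, birkhoffSum, Function.comp_apply,
      (Function.Commute.iterate_self T _).eq]
  simp only [h₄] at h₂
  exact sub_eq_zero.1 (tendsto_nhds_unique (h₂.sub h₁) h₃)

lemma tendsto_birkhoffAverage_indicator (hF : F ≤ atTop)
    (h : Tendsto (fun n => empiricalMeasure T n x) F (𝓝 μ.toFiniteMeasure))
    {S : Set X} (hS : MeasurableSet S) (hS' : (μ : Measure X) (frontier S) = 0) :
    Tendsto (fun n => birkhoffAverage ℝ T (S.indicator 1) n x) F (𝓝 ((μ : Measure X).real S)) := by
  have hex : ∀ n, ∃ ν : ProbabilityMeasure X, n ≠ 0 →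
      ν.toFiniteMeasure = empiricalMeasure T n x := by
    intro n
    by_cases hn : n = 0
    · exact ⟨μ, fun h => absurd hn h⟩
    · refine ⟨⟨empiricalMeasure T n x, ⟨?_⟩⟩, fun _ => rfl⟩
      rw [← FiniteMeasure.ennreal_mass, mass_empiricalMeasure T hn x]
      rfl
  choose ν hν using hex
  have hne : ∀ᶠ n in F, n ≠ 0 := hF (eventually_ne_atTop 0)
  have hlim : Tendsto ν F (𝓝 μ) := by
    rw [ProbabilityMeasure.tendsto_nhds_iff_toFiniteMeasure_tendsto_nhds]
    exact h.congr' (hne.mono fun n hn => (hν n hn).symm)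
  have key := ProbabilityMeasure.tendsto_measure_of_null_frontier_of_tendsto' hlim hS'
  have key' := (ENNReal.tendsto_toReal (measure_ne_top _ _)).comp key
  refine key'.congr' (hne.mono fun n hn => ?_)
  simp only [← integral_empiricalMeasure]
  rw [← hν n hn, integral_indicator_one hS]
  rfl

end Empirical

/-! ### Partitions with negligible boundaries -/

section Partition

variable {X : Type*} [MetricSpace X] [MeasurableSpace X] [BorelSpace X]

lemma measure_frontier_iInter_eq_zero {X ι : Type*} [TopologicalSpace X] [MeasurableSpace X]
    [Finite ι] (μ : Measure X) {S : ι → Set X}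
    (h : ∀ i, μ (frontier (S i)) = 0) : μ (frontier (⋂ i, S i)) = 0 := by
  classical
  cases nonempty_fintype ι
  have (s : Finset ι) : μ (frontier (⋂ i ∈ s, S i)) = 0 := by
    induction s using Finset.induction_on with
    | empty => simp
    | insert a s _ ih =>
      rw [Finset.set_biInter_insert]
      exact null_frontier_inter (h a) ih
  simpa using this Finset.univ

/-- A finite cover by balls is refined by a partition whose cells have negligible boundaries. -/
lemma exists_partition_null_frontier {k : ℕ} {c : Fin k → X} {a b : ℝ} (hab : a < b)
    (hc : ∀ y, ∃ i, dist y (c i) < a) (μ : Measure X) [SFinite μ] :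
    ∃ ξ : X → Fin k, Measurable ξ ∧ (∀ y, dist y (c (ξ y)) < b) ∧
      ∀ i, μ (frontier (ξ ⁻¹' {i})) = 0 := by
  choose r hr hr' using fun i => exists_null_frontier_thickening μ {c i} hab
  simp only [Metric.thickening_singleton] at hr'
  -- Each point is labelled by the first ball containing it, so every cell is a finite Boolean
  -- combination of balls with null frontiers.
  have hex : ∀ y, ∃ i, y ∈ Metric.ball (c i) (r i) ∧ ∀ j < i, y ∉ Metric.ball (c j) (r j) := by
    intro y
    obtain ⟨i, hi⟩ := hc y
    let W : Set (Fin k) := {i | y ∈ Metric.ball (c i) (r i)}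
    obtain ⟨i₀, hi₀, hmin⟩ := wellFounded_lt.has_min W ⟨i, hi.trans (hr i).1⟩
    exact ⟨i₀, hi₀, fun j hj hj' => hmin j hj' hj⟩
  choose ξ hξ hξ' using hex
  have hpre : ∀ i, ξ ⁻¹' {i} = Metric.ball (c i) (r i) ∩
      ⋂ j : Set.Iio i, (Metric.ball (c j) (r j))ᶜ := by
    intro i
    ext y
    simp only [Set.mem_preimage, Set.mem_singleton_iff, Set.mem_inter_iff, Set.mem_iInter,
      Set.mem_compl_iff, Subtype.forall, Set.mem_Iio]
    constructor
    · rintro rfl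
      exact ⟨hξ y, hξ' y⟩
    · rintro ⟨h₁, h₂⟩
      rcases lt_trichotomy (ξ y) i with h | h | h
      · exact absurd (hξ y) (h₂ _ h)
      · exact h
      · exact absurd h₁ (hξ' y _ h)
  refine ⟨ξ, measurable_to_countable' fun i => ?_, fun y => ?_, fun i => ?_⟩
  · rw [hpre]
    exact measurableSet_ball.inter (MeasurableSet.iInter fun j => measurableSet_ball.compl)
  · exact lt_trans (hξ y) (hr _).2
  · rw [hpre]
    exact null_frontier_inter (hr' i)
      (measure_frontier_iInter_eq_zero μ fun j => by rw [frontier_compl]; exact hr' j)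

lemma measure_frontier_cylinder_eq_zero {T : X → X} (hT : Continuous T) {μ : Measure X}
    (hμ : MeasurePreserving T μ μ) {k : ℕ} {ξ : X → Fin k}
    (hξ : ∀ i, μ (frontier (ξ ⁻¹' {i})) = 0) {m : ℕ} (a : Fin m → Fin k) :
    μ (frontier {x | ∀ j : Fin m, ξ (T^[j] x) = a j}) = 0 := by
  have : {x | ∀ j : Fin m, ξ (T^[j] x) = a j} = ⋂ j : Fin m, T^[j] ⁻¹' (ξ ⁻¹' {a j}) := by
    ext; simp
  rw [this]
  refine measure_frontier_iInter_eq_zero μ fun j => ?_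
  refine measure_mono_null ((hT.iterate j).frontier_preimage_subset _) ?_
  rw [(hμ.iterate j).measure_preimage isClosed_frontier.measurableSet.nullMeasurableSet]
  exact hξ _

end Partition

/-! ### Code lengths and averages along residue classes -/

section Weights

/-- Rational code lengths that nearly realise the Shannon entropy of a probability vector. -/
lemma exists_rat_code {A : Type*} [Fintype A] {p : A → ℝ} (hp : ∀ a, 0 ≤ p a)
    (hsum : ∑ a, p a = 1) {δ : ℝ} (hδ : 0 < δ) :
    ∃ q : A → ℚ, ∑ a, Real.exp (-(q a : ℝ)) ≤ Real.exp δ ∧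
      ∑ a, p a * q a ≤ ∑ a, Real.negMulLog (p a) + δ := by
  have hA : 0 < (Fintype.card A : ℝ) := by
    rcases isEmpty_or_nonempty A with h | h
    · simp at hsum
    · exact_mod_cast Fintype.card_pos
  set η : ℝ := δ / Fintype.card A with hη
  have hη0 : 0 < η := div_pos hδ hA
  choose q hq₁ hq₂ using fun a =>
    -- The shift by `η` keeps the logarithm meaningful when `p a = 0`; the shifts total `δ`, and `1
    -- + δ ≤ exp δ`.
    exists_rat_btwn (show -Real.log (p a + η) < -Real.log (p a + η) + δ by linarith)
  refine ⟨q, ?_, ?_⟩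
  · calc ∑ a, Real.exp (-(q a : ℝ)) ≤ ∑ a, (p a + η) := by
          refine Finset.sum_le_sum fun a _ => ?_
          have : 0 < p a + η := by linarith [hp a]
          rw [← Real.le_log_iff_exp_le this]
          linarith [hq₁ a]
      _ = δ + 1 := by
          rw [Finset.sum_add_distrib, hsum]
          simp only [Finset.sum_const, Finset.card_univ, nsmul_eq_mul, hη]
          field_simp
          ring
      _ ≤ Real.exp δ := Real.add_one_le_exp δ
  · calc ∑ a, p a * q a ≤ ∑ a, (Real.negMulLog (p a) + p a * δ) := by
          refine Finset.sum_le_sum fun a _ => ?_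
          rcases (hp a).eq_or_lt with h | h
          · simp [← h]
          · have hlog : Real.log (p a) ≤ Real.log (p a + η) :=
              Real.log_le_log h (by linarith)
            have := mul_le_mul_of_nonneg_left
              (show (q a : ℝ) ≤ -Real.log (p a) + δ by linarith [hq₂ a]) h.le
            simp only [Real.negMulLog]
            linarith
      _ = _ := by rw [Finset.sum_add_distrib, ← Finset.sum_mul, hsum, one_mul]

lemma sum_range_mul_eq_sum_residues (f : ℕ → ℝ) (m L : ℕ) :
    ∑ j ∈ Finset.range (L * m), f j =
      ∑ r ∈ Finset.range m, ∑ i ∈ Finset.range L, f (r + i * m) := by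
  rw [Finset.sum_comm]
  induction L with
  | zero => simp
  | succ L ih =>
    rw [add_mul, one_mul, Finset.sum_range_add, ih, Finset.sum_range_succ]
    simp [add_comm]

/-- If the averages of a bounded sequence are frequently small, then so are its averages along
some residue class. -/
lemma exists_residue_frequently_le {f : ℕ → ℝ} {M : ℝ} (hM : ∀ j, |f j| ≤ M) {m : ℕ} (hm : 0 < m)
    {c c' : ℝ} (hc : c < c')
    (h : ∃ᶠ n : ℕ in atTop, ∑ j ∈ Finset.range n, f j ≤ n * c) :
    ∃ r, ∃ᶠ L : ℕ in atTop, ∑ i ∈ Finset.range L, f (r + i * m) ≤ L * c' := by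
  by_contra! hcon
  have hall : ∀ᶠ L : ℕ in atTop, ∀ r ∈ Finset.range m,
      L * c' < ∑ i ∈ Finset.range L, f (r + i * m) :=
    (Finset.eventually_all _).2 fun r _ => hcon r
  -- The left side bounds the effect of the incomplete last block, of length `n % m`.
  have hbig : ∀ᶠ L : ℕ in atTop, m * (|c| + M) < (L * m : ℝ) * (c' - c) := by
    have : Tendsto (fun L : ℕ => (L : ℝ) * (m * (c' - c))) atTop atTop :=
      tendsto_natCast_atTop_atTop.atTop_mul_const
        (mul_pos (by exact_mod_cast hm) (by linarith))
    filter_upwards [this.eventually_gt_atTop (m * (|c| + M))] with L hL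
    linarith
  have hdiv : Tendsto (fun n : ℕ => n / m) atTop atTop := Nat.tendsto_div_const_atTop hm.ne'
  obtain ⟨n, hn, hn₁, hn₂⟩ := (h.and_eventually (hdiv.eventually (hall.and hbig))).exists
  set L := n / m with hL
  have hn_eq : n = L * m + n % m := by rw [hL, mul_comm]; exact (Nat.div_add_mod n m).symm
  have hmod : n % m < m := Nat.mod_lt _ hm
  have hM0 : 0 ≤ M := (abs_nonneg _).trans (hM 0)
  have htail : -(m * M) ≤ ∑ i ∈ Finset.range (n % m), f (L * m + i) := by
    have h1 : |∑ i ∈ Finset.range (n % m), f (L * m + i)| ≤ (n % m : ℕ) * M := by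
      refine (Finset.abs_sum_le_sum_abs _ _).trans ?_
      refine (Finset.sum_le_sum fun i _ => hM (L * m + i)).trans ?_
      simp
    have h2 : ((n % m : ℕ) : ℝ) * M ≤ m * M :=
      mul_le_mul_of_nonneg_right (by exact_mod_cast hmod.le) hM0
    linarith [neg_abs_le (∑ i ∈ Finset.range (n % m), f (L * m + i))]
  have hmain : (m : ℝ) * (L * c') ≤ ∑ j ∈ Finset.range (L * m), f j := by
    rw [sum_range_mul_eq_sum_residues]
    calc (m : ℝ) * (L * c') = ∑ r ∈ Finset.range m, (L * c' : ℝ) := by simp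
      _ ≤ _ := Finset.sum_le_sum fun r hr => (hn₁ r hr).le
  have hsplit : ∑ j ∈ Finset.range n, f j = ∑ j ∈ Finset.range (L * m), f j +
      ∑ i ∈ Finset.range (n % m), f (L * m + i) := by
    conv_lhs => rw [hn_eq]
    rw [Finset.sum_range_add]
  have hcast : (n : ℝ) = L * m + (n % m : ℕ) := by exact_mod_cast hn_eq
  have hc1 : ((n % m : ℕ) : ℝ) * c ≤ m * |c| :=
    (mul_le_mul_of_nonneg_left (le_abs_self c) (Nat.cast_nonneg _)).trans
      (mul_le_mul_of_nonneg_right (by exact_mod_cast hmod.le) (abs_nonneg c))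
  rw [hsplit, hcast] at hn
  nlinarith

end Weights

/-! ### Covers by Bowen balls and counting of codes -/

section Covers

variable {X : Type*} [MetricSpace X]

lemma bowenPreMeasure_mono (T : X → X) (s : ℝ≥0) {Z Z' : Set X} (h : Z ⊆ Z') (ε : ℝ) (N : ℕ) :
    bowenPreMeasure T s Z ε N ≤ bowenPreMeasure T s Z' ε N :=
  le_iInf₂ fun R hR => iInf₂_le_of_le R
    ⟨hR.countable, hR.one_le, hR.le, h.trans hR.covers⟩ le_rfl

lemma topEntropy_mono (T : X → X) {Z Z' : Set X} (h : Z ⊆ Z') :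
    topEntropy T Z ≤ topEntropy T Z' := by
  refine iSup₂_mono fun ε _ => le_iInf₂ fun s hs => iInf₂_le s ?_
  exact le_antisymm ((iSup_mono fun N => bowenPreMeasure_mono T s h ε N).trans hs.le) zero_le

lemma bowenPreMeasure_iUnion_eq_zero {ι : Type*} [Countable ι] (T : X → X) (s : ℝ≥0)
    {Z : ι → Set X} {ε : ℝ} {N : ℕ} (h : ∀ i, bowenPreMeasure T s (Z i) ε N = 0) :
    bowenPreMeasure T s (⋃ i, Z i) ε N = 0 := by
  refine le_antisymm (le_of_forall_pos_le_add fun θ hθ => ?_) zero_le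
  obtain ⟨θ', hθ', hsum⟩ := ENNReal.exists_pos_sum_of_countable' hθ.ne' ι
  have hex : ∀ i, ∃ R, IsBowenCover T (Z i) ε N R ∧
      ∑' p : R, ENNReal.ofReal (Real.exp (-(s : ℝ) * ((p : X × ℕ).2 : ℝ))) < θ' i := by
    intro i
    have := (h i).trans_lt (hθ' i)
    simp only [bowenPreMeasure, iInf_lt_iff] at this
    obtain ⟨R, hR, hlt⟩ := this
    exact ⟨R, hR, hlt⟩
  choose R hR hlt using hex
  have hcov : IsBowenCover T (⋃ i, Z i) ε N (⋃ i, R i) := by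
    refine ⟨Set.countable_iUnion fun i => (hR i).countable, ?_, ?_, ?_⟩
    · intro p hp
      obtain ⟨i, hi⟩ := Set.mem_iUnion.1 hp
      exact (hR i).one_le p hi
    · intro p hp
      obtain ⟨i, hi⟩ := Set.mem_iUnion.1 hp
      exact (hR i).le p hi
    · refine Set.iUnion_subset fun i => (hR i).covers.trans ?_
      exact Set.biUnion_subset_biUnion_left (Set.subset_iUnion R i)
  rw [zero_add]
  refine (iInf₂_le _ hcov).trans ((ENNReal.tsum_iUnion_le_tsum
    (fun p : X × ℕ => ENNReal.ofReal (Real.exp (-(s : ℝ) * (p.2 : ℝ)))) R).trans ?_)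
  exact (ENNReal.tsum_le_tsum fun i => (hlt i).le).trans hsum.le

/-- The points whose first `r` iterates follow the itinerary `u` up to `ρ`, and whose subsequent
iterates follow, for infinitely many `L`, some concatenation of `L` words of length `m` with mean
code length at most `κ`. -/
def codedSet (T : X → X) {k : ℕ} (c : Fin k → X) (ρ κ : ℝ) {m : ℕ}
    (q : (Fin m → Fin k) → ℚ) {r : ℕ} (u : Fin r → Fin k) : Set X :=
  {y | (∀ j : Fin r, dist (T^[j] y) (c (u j)) < ρ) ∧
    ∃ᶠ L : ℕ in atTop, ∃ b : Fin L → Fin m → Fin k, ∑ i, (q (b i) : ℝ) ≤ L * κ ∧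
      ∀ (i : Fin L) (l : Fin m), dist (T^[r + i * m + l] y) (c (b i l)) < ρ}

/-- A Chernoff-type count: on the constraint `1 ≤ exp (L * κ - ∑ q (b i))`, and the unrestricted sum
of `exp (-∑ q (b i))` factors as the `L`-th power of the Kraft sum. -/
lemma sum_card_code_le {A : Type*} [Fintype A] {q : A → ℚ} {δ κ s : ℝ}
    (hq : ∑ a, Real.exp (-(q a : ℝ)) ≤ Real.exp δ) {m : ℕ} (L : ℕ) :
    ∑' b : {b : Fin L → A // ∑ i, (q (b i) : ℝ) ≤ L * κ},
        (fun _ => ENNReal.ofReal (Real.exp (-s * (L * m)))) b ≤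
      ENNReal.ofReal (Real.exp (δ + κ - s * m)) ^ L := by
  classical
  rw [tsum_fintype, ← ENNReal.ofReal_sum_of_nonneg (fun _ _ => (Real.exp_pos _).le),
    ← ENNReal.ofReal_pow (Real.exp_pos _).le]
  refine ENNReal.ofReal_le_ofReal ?_
  calc ∑ b : {b : Fin L → A // ∑ i, (q (b i) : ℝ) ≤ L * κ}, Real.exp (-s * (L * m))
      ≤ ∑ b : {b : Fin L → A // ∑ i, (q (b i) : ℝ) ≤ L * κ},
        (∏ i, Real.exp (-(q (b.1 i) : ℝ))) * Real.exp (κ - s * m) ^ L := by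
        refine Finset.sum_le_sum fun b _ => ?_
        rw [← Real.exp_sum, ← Real.exp_nat_mul, ← Real.exp_add, Finset.sum_neg_distrib]
        refine Real.exp_le_exp.2 ?_
        have := b.2
        linarith
    _ ≤ ∑ b : Fin L → A, (∏ i, Real.exp (-(q (b i) : ℝ))) * Real.exp (κ - s * m) ^ L := by
        refine (Finset.sum_map Finset.univ (Function.Embedding.subtype _)
          fun b : Fin L → A => (∏ i, Real.exp (-(q (b i) : ℝ))) * Real.exp (κ - s * m) ^ L
          ).symm.trans_le ?_
        exact Finset.sum_le_sum_of_subset_of_nonneg (Finset.subset_univ _)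
          fun b _ _ => by positivity
    _ = (∑ a, Real.exp (-(q a : ℝ))) ^ L * Real.exp (κ - s * m) ^ L := by
        rw [← Finset.sum_mul, Fintype.sum_pow]
    _ ≤ Real.exp δ ^ L * Real.exp (κ - s * m) ^ L := by
        gcongr
    _ = Real.exp (δ + κ - s * m) ^ L := by
        rw [← mul_pow, ← Real.exp_add, add_sub_assoc]

/-- Each point is coded at arbitrarily large `L`, so the words with `L ≥ N'` suffice for a cover;
its weight is at most the tail of a geometric series of ratio `z < 1`. -/
lemma bowenPreMeasure_codedSet (T : X → X) {k : ℕ} (c : Fin k → X) {ρ κ δ : ℝ} {m : ℕ}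
    (hm : 0 < m) {q : (Fin m → Fin k) → ℚ} (hq : ∑ a, Real.exp (-(q a : ℝ)) ≤ Real.exp δ)
    {r : ℕ} (u : Fin r → Fin k) {s : ℝ≥0} (hs : δ + κ < s * m) (N : ℕ) :
    bowenPreMeasure T s (codedSet T c ρ κ q u) (2 * ρ) N = 0 := by
  classical
  set z : ℝ≥0∞ := ENNReal.ofReal (Real.exp (δ + κ - s * m)) with hz
  have hz1 : z < 1 := by
    rw [hz, ENNReal.ofReal_lt_one, Real.exp_lt_one_iff]
    linarith
  let W : (L : ℕ) → (Fin L → Fin m → Fin k) → Set X := fun L b =>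
    {y | (∀ j : Fin r, dist (T^[j] y) (c (u j)) < ρ) ∧
      ∀ (i : Fin L) (l : Fin m), dist (T^[r + i * m + l] y) (c (b i l)) < ρ}
  -- Two points that follow the same centres up to `ρ` stay within `2 * ρ` of each other.
  have hball : ∀ L b, ∀ y ∈ W L b, W L b ⊆ bowenBall T (r + L * m) y (2 * ρ) := by
    intro L b y hy y' hy' j hj
    have key : ∃ x, dist (T^[j] y) x < ρ ∧ dist (T^[j] y') x < ρ := by
      by_cases hjr : j < r
      · exact ⟨_, hy.1 ⟨j, hjr⟩, hy'.1 ⟨j, hjr⟩⟩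
      · have h1 : (j - r) / m < L := by
          rw [Nat.div_lt_iff_lt_mul hm]; omega
        have h2 : (j - r) % m < m := Nat.mod_lt _ hm
        have h3 : r + (j - r) / m * m + (j - r) % m = j := by
          have := Nat.div_add_mod' (j - r) m
          omega
        have h4 := hy.2 ⟨_, h1⟩ ⟨_, h2⟩
        have h5 := hy'.2 ⟨_, h1⟩ ⟨_, h2⟩
        simp only [h3] at h4 h5
        exact ⟨_, h4, h5⟩
    obtain ⟨x, h1, h2⟩ := key
    linarith [dist_triangle_right (T^[j] y') (T^[j] y) x]
  let I : ℕ → Type := fun L => {b : Fin L → Fin m → Fin k // ∑ i, (q (b i) : ℝ) ≤ L * κ}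
  let R : (N' : ℕ) → Set (X × ℕ) := fun N' => ⋃ L : ℕ, ⋃ b : I (N' + L),
    {p | ∃ h : (W (N' + L) b.1).Nonempty, p = (h.some, r + (N' + L) * m)}
  have hcov : ∀ N', N + 1 ≤ N' → IsBowenCover T (codedSet T c ρ κ q u) (2 * ρ) N (R N') := by
    intro N' hN'
    have hlen : ∀ p ∈ R N', N + 1 ≤ p.2 := by
      intro p hp
      simp only [R, Set.mem_iUnion] at hp
      obtain ⟨L, b, h, rfl⟩ := hp
      have : N' + L ≤ (N' + L) * m := Nat.le_mul_of_pos_right _ hm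
      simp only
      omega
    refine ⟨?_, fun p hp => by have := hlen p hp; omega,
      fun p hp => by have := hlen p hp; omega, ?_⟩
    · refine Set.countable_iUnion fun L => Set.countable_iUnion fun b => ?_
      refine Set.Subsingleton.countable ?_
      rintro _ ⟨_, rfl⟩ _ ⟨_, rfl⟩
      rfl
    · rintro y ⟨hy₁, hy₂⟩
      obtain ⟨L', hL', b, hb, hb'⟩ := frequently_atTop.1 hy₂ N'
      obtain ⟨L, rfl⟩ := Nat.exists_eq_add_of_le hL'
      have hyW : y ∈ W (N' + L) b := ⟨hy₁, hb'⟩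
      have hne : (W (N' + L) b).Nonempty := ⟨y, hyW⟩
      simp only [Set.mem_iUnion]
      refine ⟨(hne.some, r + (N' + L) * m), ?_, hball _ _ _ hne.some_mem hyW⟩
      simp only [R, Set.mem_iUnion]
      exact ⟨L, ⟨b, hb⟩, hne, rfl⟩
  have hsum : ∀ N', ∑' p : R N', ENNReal.ofReal (Real.exp (-(s : ℝ) * ((p : X × ℕ).2 : ℝ))) ≤
      z ^ N' * (1 - z)⁻¹ := by
    intro N'
    let g : X × ℕ → ℝ≥0∞ := fun p => ENNReal.ofReal (Real.exp (-(s : ℝ) * (p.2 : ℝ)))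
    calc ∑' p : R N', g p ≤ ∑' L : ℕ, ∑' b : I (N' + L),
          ENNReal.ofReal (Real.exp (-(s : ℝ) * ((N' + L : ℕ) * m))) := by
          refine (ENNReal.tsum_iUnion_le_tsum g _).trans (ENNReal.tsum_le_tsum fun L => ?_)
          refine (ENNReal.tsum_iUnion_le_tsum g _).trans (ENNReal.tsum_le_tsum fun b => ?_)
          by_cases h : (W (N' + L) b.1).Nonempty
          · have : {p | ∃ h : (W (N' + L) b.1).Nonempty, p = (h.some, r + (N' + L) * m)} =
                {(h.some, r + (N' + L) * m)} := by
              ext p; simp [h]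
            rw [this, tsum_singleton]
            refine ENNReal.ofReal_le_ofReal (Real.exp_le_exp.2 ?_)
            push_cast
            have : (0 : ℝ) ≤ s * r := by positivity
            linarith
          · have : {p : X × ℕ | ∃ h : (W (N' + L) b.1).Nonempty,
                p = (h.some, r + (N' + L) * m)} = ∅ := by
              ext p; simp [h]
            rw [this]
            simp
      _ ≤ ∑' L : ℕ, z ^ (N' + L) :=
          ENNReal.tsum_le_tsum fun L => sum_card_code_le hq (N' + L)
      _ = z ^ N' * (1 - z)⁻¹ := by
          simp only [pow_add, ENNReal.tsum_mul_left, ENNReal.tsum_geometric]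
  have hlim : Tendsto (fun N' => z ^ N' * (1 - z)⁻¹) atTop (𝓝 0) := by
    have := ENNReal.Tendsto.mul_const (ENNReal.tendsto_pow_atTop_nhds_zero_of_lt_one hz1)
      (b := (1 - z)⁻¹) (Or.inr (by simpa [tsub_eq_zero_iff_le] using hz1))
    simpa using this
  refine le_antisymm (ge_of_tendsto hlim ?_) zero_le
  filter_upwards [eventually_ge_atTop (N + 1)] with N' hN'
  exact (iInf₂_le _ (hcov N' hN')).trans (hsum N')

end Covers

/-! ### Bowen's upper bound -/

section Upper

variable {X : Type*} [MetricSpace X] [CompactSpace X] [MeasurableSpace X] [BorelSpace X]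

/-- A point whose orbit has a limit distribution `μ` of entropy at most `t` is coded by words of
some length `m` with mean code length slightly larger than `m * t`. -/
lemma exists_mem_codedSet {T : X → X} (hT : Continuous T) {k : ℕ} {c : Fin k → X} {ρ' ρ : ℝ}
    (hρ : ρ' < ρ) (hc : ∀ y, ∃ i, dist y (c i) < ρ') {t : ℝ≥0} {δ : ℝ} (hδ : 0 < δ)
    {x : X} {F : Filter ℕ} [F.NeBot] (hF : F ≤ atTop) {μ : ProbabilityMeasure X}
    (hlim : Tendsto (fun n => empiricalMeasure T n x) F (𝓝 μ.toFiniteMeasure))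
    (hμ : measureEntropy T (μ : Measure X) ≤ t) :
    ∃ m : ℕ, 0 < m ∧ ∃ q : (Fin m → Fin k) → ℚ, ∑ a, Real.exp (-(q a : ℝ)) ≤ Real.exp δ ∧
      ∃ (r : ℕ) (u : Fin r → Fin k), x ∈ codedSet T c ρ (m * (t + 3 * δ)) q u := by
  have hinv := measurePreserving_of_tendsto_empiricalMeasure hF hT hlim
  obtain ⟨ξ, hξm, hξc, hξf⟩ := exists_partition_null_frontier hρ hc (μ : Measure X)
  have hent : partitionEntropy T (μ : Measure X) ξ < ENNReal.ofReal (t + δ) := by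
    refine lt_of_le_of_lt (le_trans ?_ hμ) ?_
    · exact le_iSup_of_le k (le_iSup_of_le ξ (le_iSup_of_le hξm le_rfl))
    · rw [ENNReal.lt_ofReal_iff_toReal_lt (by simp)]
      simpa using hδ
  obtain ⟨m, hm, hm0⟩ := ((eventually_lt_of_limsup_lt hent).and (eventually_gt_atTop 0)).exists
  have hm0' : (0 : ℝ) < m := by exact_mod_cast hm0
  have hm1 : (1 : ℝ) ≤ m := by exact_mod_cast hm0
  have hH : joinEntropy T (μ : Measure X) ξ m < (t + δ) * m := by
    rw [ENNReal.ofReal_lt_ofReal_iff (by positivity), div_lt_iff₀ hm0'] at hm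
    exact hm
  let w : X → Fin m → Fin k := fun y j => ξ (T^[j] y)
  let C : (Fin m → Fin k) → Set X := fun a => {y | ∀ j : Fin m, ξ (T^[j] y) = a j}
  have hwC : ∀ a, C a = w ⁻¹' {a} := fun a => by
    ext y
    simp [C, w, funext_iff]
  have hw : Measurable w := measurable_pi_lambda _ fun j => hξm.comp (hT.iterate j).measurable
  have hCm : ∀ a, MeasurableSet (C a) := fun a => by
    rw [hwC]
    exact hw (measurableSet_singleton a)
  have hsum : ∑ a, (μ : Measure X).real (C a) = 1 := by
    simp only [hwC]
    rw [sum_measureReal_preimage_singleton _ fun a _ => hw (measurableSet_singleton a)]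
    simp
  obtain ⟨q, hq, hqH⟩ := exists_rat_code (p := fun a => (μ : Measure X).real (C a))
    (fun a => measureReal_nonneg) hsum hδ
  have havg : Tendsto (fun n => birkhoffAverage ℝ T (fun y => (q (w y) : ℝ)) n x) F
      (𝓝 (∑ a, (μ : Measure X).real (C a) * q a)) := by
    have h1 := tendsto_finsetSum Finset.univ fun a _ =>
      (tendsto_birkhoffAverage_indicator hF hlim (hCm a)
        (measure_frontier_cylinder_eq_zero hT hinv hξf a)).mul_const (q a : ℝ)
    refine h1.congr fun n => ?_
    simp only [birkhoffAverage, birkhoffSum, smul_eq_mul, mul_assoc, ← Finset.mul_sum,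
      Finset.sum_mul]
    rw [Finset.sum_comm]
    congr 1
    refine Finset.sum_congr rfl fun j _ => ?_
    rw [Finset.sum_eq_single (w (T^[j] x))]
    · simp [hwC]
    · intro a _ ha
      simp [hwC, ha.symm]
    · simp
  -- The join costs less than `m * (t + δ)` and the code at most `δ ≤ m * δ` more.
  have hlt : ∑ a, (μ : Measure X).real (C a) * q a < m * (t + 2 * δ) + δ / 2 := by
    have : joinEntropy T (μ : Measure X) ξ m =
      ∑ a, Real.negMulLog ((μ : Measure X).real (C a)) := rfl
    nlinarith
  have hfreq : ∃ᶠ n : ℕ in atTop, ∑ j ∈ Finset.range n, (q (w (T^[j] x)) : ℝ) ≤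
      n * (m * (t + 2 * δ) + δ / 2) := by
    have hev : ∀ᶠ n : ℕ in F, ∑ j ∈ Finset.range n, (q (w (T^[j] x)) : ℝ) ≤
        n * (m * (t + 2 * δ) + δ / 2) := by
      filter_upwards [havg.eventually_lt_const hlt, hF (eventually_gt_atTop 0)] with n hn hn0
      have hn0' : (0 : ℝ) < n := by exact_mod_cast hn0
      simp only [birkhoffAverage, birkhoffSum, smul_eq_mul] at hn
      rw [inv_mul_lt_iff₀ hn0'] at hn
      exact hn.le
    exact hev.frequently.filter_mono hF
  -- Passage from overlapping windows, starting at every time, to consecutive blocks starting at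
  -- `r`.
  obtain ⟨r, hr⟩ := exists_residue_frequently_le (c' := m * (t + 3 * δ))
    (M := ∑ a, |(q a : ℝ)|)
    (fun j => Finset.single_le_sum (f := fun a => |(q a : ℝ)|) (fun a _ => abs_nonneg _)
      (Finset.mem_univ (w (T^[j] x)))) hm0 (by nlinarith) hfreq
  refine ⟨m, hm0, q, hq, r, fun j => ξ (T^[j] x), fun j => hξc _, hr.mono fun L hL => ?_⟩
  refine ⟨fun i => w (T^[r + i * m] x), ?_, fun i l => ?_⟩
  · rwa [Fin.sum_univ_eq_sum_range (fun i => (q (w (T^[r + i * m] x)) : ℝ))]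
  · have : T^[r + i * m + l] x = T^[l] (T^[r + i * m] x) := by
      rw [← Function.iterate_add_apply, add_comm (l : ℕ)]
    rw [this]
    exact hξc _

/-- Bowen's bound: if the orbit of every point of `Z` has a limit distribution of entropy at most
`t`, then `h_top(Z) ≤ t`. -/
theorem topEntropy_le_of_forall_exists_limit {T : X → X} (hT : Continuous T) {Z : Set X} {t : ℝ≥0}
    (hZ : ∀ x ∈ Z, ∃ (F : Filter ℕ) (μ : ProbabilityMeasure X), F.NeBot ∧ F ≤ atTop ∧
      Tendsto (fun n => empiricalMeasure T n x) F (𝓝 μ.toFiniteMeasure) ∧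
      measureEntropy T (μ : Measure X) ≤ t) :
    topEntropy T Z ≤ t := by
  refine iSup₂_le fun ε hε => le_of_forall_gt fun a ha => ?_
  obtain ⟨s, hts, hsa⟩ := ENNReal.lt_iff_exists_nnreal_btwn.1 ha
  refine lt_of_le_of_lt (iInf₂_le s (ENNReal.iSup_eq_zero.2 fun N => ?_)) hsa
  have hts' : (t : ℝ) < s := by exact_mod_cast hts
  -- With `s = t + 5 * δ` and `m ≥ 1`, the required `δ + m * (t + 3 * δ) < s * m` holds.
  set δ : ℝ := (s - t) / 5 with hδ_def
  have hδ : 0 < δ := by rw [hδ_def]; linarith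
  obtain ⟨k, c, hc⟩ : ∃ (k : ℕ) (c : Fin k → X), ∀ y, ∃ i, dist y (c i) < ε / 4 := by
    obtain ⟨S, -, hSf, hS⟩ := finite_cover_balls_of_compact (isCompact_univ (X := X))
      (show 0 < ε / 4 by linarith)
    obtain ⟨k, c, -, rfl⟩ := hSf.fin_param
    refine ⟨k, c, fun y => ?_⟩
    simpa using hS (Set.mem_univ y)
  -- `J` is countable because the code lengths are rational and the words finite.
  let J : Type := Σ m : ℕ, {q : (Fin m → Fin k) → ℚ // 0 < m ∧
    ∑ a, Real.exp (-(q a : ℝ)) ≤ Real.exp δ} × Σ r : ℕ, Fin r → Fin k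
  have hcover : Z ⊆ ⋃ i : J, codedSet T c (ε / 2) (i.1 * (t + 3 * δ)) i.2.1.1 i.2.2.2 := by
    intro x hx
    obtain ⟨F, μ, hF, hFle, hlim, hμ⟩ := hZ x hx
    obtain ⟨m, hm, q, hq, r, u, hmem⟩ := exists_mem_codedSet hT
      (show ε / 4 < ε / 2 by linarith) hc hδ hFle hlim hμ
    exact Set.mem_iUnion.2 ⟨⟨m, ⟨q, hm, hq⟩, r, u⟩, hmem⟩
  refine le_antisymm ((bowenPreMeasure_mono T s hcover ε N).trans_eq ?_) zero_le
  refine bowenPreMeasure_iUnion_eq_zero T s fun i => ?_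
  have hm1 : (1 : ℝ) ≤ i.1 := by exact_mod_cast i.2.1.2.1
  have key := bowenPreMeasure_codedSet T c (ρ := ε / 2) (κ := i.1 * (t + 3 * δ)) i.2.1.2.1
    i.2.1.2.2 i.2.2.2 (s := s) (by
      have : (s : ℝ) = t + 5 * δ := by rw [hδ_def]; ring
      rw [this]
      nlinarith) N
  rwa [mul_div_cancel₀ ε two_ne_zero] at key

end Upper

/-! ### Level sets and their limit distributions -/

section Level

variable {X : Type*} [MetricSpace X] [CompactSpace X] [MeasurableSpace X] [BorelSpace X]
  {B : Type*} [NormedAddCommGroup B] [NormedSpace ℝ B]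

lemma birkhoffAverage_weakDual_apply {X : Type*} (T : X → X) (Φ : X → WeakDual ℝ B) (n : ℕ)
    (x : X) (w : B) :
    birkhoffAverage ℝ T Φ n x w = birkhoffAverage ℝ T (fun y => Φ y w) n x :=
  map_birkhoffAverage ℝ ℝ (LinearMap.applyₗ w ∘ₗ ContinuousLinearMap.coeLM ℝ) T Φ n x

lemma tendsto_birkhoffAverage_weakDual {T : X → X} {Φ : X → WeakDual ℝ B} (hΦ : Continuous Φ)
    {x : X} {F : Filter ℕ} {μ : ProbabilityMeasure X}
    (h : Tendsto (fun n => empiricalMeasure T n x) F (𝓝 μ.toFiniteMeasure)) (w : B) :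
    Tendsto (fun n => ((birkhoffAverage ℝ T Φ n x w : ℝ) : EReal)) F
      (𝓝 ((∫ y, Φ y w ∂(μ : Measure X) : ℝ) : EReal)) := by
  simp only [birkhoffAverage_weakDual_apply]
  exact (continuous_coe_real_ereal.tendsto _).comp
    (tendsto_birkhoffAverage_of_tendsto_empiricalMeasure h
      ((WeakDual.eval_continuous w).comp hΦ))

/-- The limit distributions of the orbits in `X_Φ(α; E)` belong to `M_Φ(α; E)`. -/
lemma mem_levelMeasures_of_tendsto {T : X → X} (hT : Continuous T) {Φ : X → WeakDual ℝ B}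
    (hΦ : Continuous Φ) {α : WeakDual ℝ B} {E : Set B} {x : X} (hx : x ∈ levelSet T Φ α E)
    {F : Filter ℕ} [F.NeBot] (hF : F ≤ atTop) {μ : ProbabilityMeasure X}
    (h : Tendsto (fun n => empiricalMeasure T n x) F (𝓝 μ.toFiniteMeasure)) :
    μ ∈ levelMeasures T Φ α E := by
  refine ⟨measurePreserving_of_tendsto_empiricalMeasure hF hT h, fun w hw => ?_⟩
  have h₁ := (tendsto_birkhoffAverage_weakDual hΦ h w).limsup_eq
  have h₂ := (limsup_le_limsup_of_le hF).trans (hx w hw)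
  rw [h₁] at h₂
  exact_mod_cast h₂

lemma genericPoints_subset_levelSet {T : X → X} {Φ : X → WeakDual ℝ B} (hΦ : Continuous Φ)
    {α : WeakDual ℝ B} {E : Set B} {μ : ProbabilityMeasure X} (hμ : μ ∈ levelMeasures T Φ α E) :
    genericPoints T μ ⊆ levelSet T Φ α E := by
  intro x hx w hw
  rw [(tendsto_birkhoffAverage_weakDual hΦ hx w).limsup_eq]
  exact_mod_cast hμ.2 w hw

end Level

end DynSys

end

theorem theorem2 {X : Type*} [MetricSpace X] [CompactSpace X] [MeasurableSpace X] [BorelSpace X]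
    {B : Type*} [NormedAddCommGroup B] [NormedSpace ℝ B] [CompleteSpace B]
    (T : X → X) (hT : Continuous T) (hsat : DynSys.IsSaturated T)
    (Φ : X → WeakDual ℝ B) (hΦ : Continuous Φ) (α : WeakDual ℝ B) (E : Set B) :
    (DynSys.levelMeasures T Φ α E = ∅ → DynSys.levelSet T Φ α E = ∅) ∧
    ((DynSys.levelMeasures T Φ α E).Nonempty →
      DynSys.topEntropy T (DynSys.levelSet T Φ α E) =
        ⨆ μ ∈ DynSys.levelMeasures T Φ α E, DynSys.measureEntropy T (μ : Measure X)) := by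
  have hlim : ∀ x ∈ DynSys.levelSet T Φ α E, ∃ (F : Filter ℕ) (μ : ProbabilityMeasure X),
      F.NeBot ∧ F ≤ atTop ∧
      Tendsto (fun n => DynSys.empiricalMeasure T n x) F (𝓝 μ.toFiniteMeasure) ∧
      μ ∈ DynSys.levelMeasures T Φ α E := by
    intro x hx
    obtain ⟨F, μ, hF, hFle, h⟩ := DynSys.exists_tendsto_empiricalMeasure T x
    exact ⟨F, μ, hF, hFle, h, DynSys.mem_levelMeasures_of_tendsto hT hΦ hx hFle h⟩
  refine ⟨fun hempty => Set.eq_empty_of_forall_notMem fun x hx => ?_, fun _ => le_antisymm ?_ ?_⟩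
  · obtain ⟨F, μ, -, -, -, hμ⟩ := hlim x hx
    rw [hempty] at hμ
    exact hμ
  -- Bowen's bound takes a finite `t`; an infinite supremum bounds everything trivially.
  · generalize ht : ⨆ μ ∈ DynSys.levelMeasures T Φ α E,
      DynSys.measureEntropy T (μ : Measure X) = t
    induction t using ENNReal.recTopCoe with
    | top => exact le_top
    | coe t =>
      refine DynSys.topEntropy_le_of_forall_exists_limit hT fun x hx => ?_
      obtain ⟨F, μ, hF, hFle, h, hμ⟩ := hlim x hx
      refine ⟨F, μ, hF, hFle, h, ?_⟩
      rw [← ht]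
      exact le_iSup₂ (f := fun (μ : ProbabilityMeasure X) (_ : μ ∈ DynSys.levelMeasures T Φ α E) =>
        DynSys.measureEntropy T (μ : Measure X)) μ hμ
  · refine iSup₂_le fun μ hμ => ?_
    rw [← hsat μ hμ.1]
    exact DynSys.topEntropy_mono T (DynSys.genericPoints_subset_levelSet hΦ hμ)
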